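/- Let $\mathbb{Q}\langle X_n\rangle$ be the algebra of noncommutative polynomials in $x_1,\dots,x_n$ over $\mathbb{Q}$, and order words over $[n]=\{1,\dots,n\}$ lexicographically (a proper prefix is smaller). A Lyndon word is a nonempty word that is smaller than each of its proper nonempty suffixes; every word has a unique factorization $w=\ell_1\ell_2\cdots\ell_k$ into Lyndon words with $\ell_1\ge\ell_2\ge\cdots\ge\ell_k$. Put $P_a=x_a$ for a letter $a$, and $P_\ell=[P_u,P_v]=P_uP_v-P_vP_u$ for a Lyndon word $\ell=uv$ of length at least $2$, where $v$ is the lexicographically smallest proper nonempty suffix of $\ell$; for any word put $P_w=P_{\ell_1}P_{\ell_2}\cdots P_{\ell_k}$. Let $M(w)$ be the shuffle product of the Lyndon factors of $w$ of length $1$, taken with multiplicity (each such factor $a$ being read as the variable $x_a$), let $L(w)=P_{w'}$, where $w'$ is the product in decreasing order of the Lyndon factors of $w$ of length greater than $1$, and let $H_w=M(w)L(w)$. Theorem. Let $w\in[n]^r$, and let $m(w)$ be the number of Lyndon factors of $w$ of length $1$, counted with multiplicity. Then $$H_w=m(w)!\,P_w+\sum_u c_u P_u ,$$ where the sum is over words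 $u\in[n]^r$ lexicographically smaller than $w$ and all $c_u\ge 0$. Moreover, for every $r\ge 0$, $\{H_w\}_{w\in[n]^r}$ is a basis of the space of homogeneous noncommutative polynomials of degree $r$ in $\mathbb{Q}\langle X_n\rangle$. -/

import Mathlib

namespace HybridBasis

/-! ### Lyndon words

Words over an alphabet are lists, compared by the lexicographic order `<` on lists, for which a
proper prefix of a word is smaller than the word. -/

section Words

variable {α : Type*} [LinearOrder α]

/-- A Lyndon word: a nonempty word that is smaller than each of its proper nonempty suffixes. -/
def IsLyndon (w : List α) : Prop :=
  w ≠ [] ∧ ∀ u v : List α, u ≠ [] → v ≠ [] → w = u ++ v → w < v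

/-- `fs` is a factorization of `w` into a weakly decreasing product of Lyndon words. -/
def IsLyndonFactorization (w : List α) (fs : List (List α)) : Prop :=
  fs.flatten = w ∧ (∀ f ∈ fs, IsLyndon f) ∧ fs.Pairwise (fun f g => g ≤ f)

theorem append_lt_append_of_not_prefix {u v : List α} (h : u < v) (hp : ¬ u <+: v)
    (x y : List α) : u ++ x < v ++ y := by
  induction u generalizing v with
  | nil => exact absurd List.nil_prefix hp
  | cons a u ih =>
    cases v with
    | nil => exact absurd h (List.not_lt_nil _)
    | cons b v =>
      rw [List.cons_lt_cons_iff] at h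
      rw [List.cons_append, List.cons_append, List.cons_lt_cons_iff]
      rcases h with h | ⟨rfl, h⟩
      · exact Or.inl h
      · refine Or.inr ⟨rfl, ih h fun hq => hp ?_⟩
        exact (List.prefix_cons_inj a).2 hq

theorem append_lt_append_left' (u : List α) {v w : List α} (h : v < w) : u ++ v < u ++ w := by
  induction u with
  | nil => exact h
  | cons a u ih =>
    rw [List.cons_append, List.cons_append, List.cons_lt_cons_iff]
    exact Or.inr ⟨rfl, ih⟩

theorem lt_append_right' (u : List α) {v : List α} (h : v ≠ []) : u < u ++ v := by
  induction u with
  | nil =>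
    cases v with
    | nil => exact absurd rfl h
    | cons b v => exact List.nil_lt_cons b v
  | cons a u ih =>
    rw [List.cons_append, List.cons_lt_cons_iff]
    exact Or.inr ⟨rfl, ih⟩

theorem IsLyndon.append {u v : List α} (hu : IsLyndon u) (hv : IsLyndon v) (h : u < v) :
    IsLyndon (u ++ v) := by
  have key : u ++ v < v := by
    by_cases hp : u <+: v
    · obtain ⟨t, rfl⟩ := hp
      have ht : t ≠ [] := by
        rintro rfl
        simp at h
      exact append_lt_append_left' u (hv.2 u t hu.1 ht rfl)
    · simpa using append_lt_append_of_not_prefix h hp v []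
  refine ⟨by simp [hu.1], fun p s hp hs hps => ?_⟩
  rcases List.append_eq_append_iff.1 hps with ⟨a, ha, hb⟩ | ⟨a, ha, hb⟩
  · by_cases ha0 : a = []
    · subst ha0
      simp only [List.nil_append] at hb
      exact hb ▸ key
    · exact key.trans (hv.2 a s ha0 hs hb)
  · by_cases ha0 : a = []
    · subst ha0
      simp only [List.nil_append] at hb
      exact hb ▸ key
    · rw [hb]
      refine append_lt_append_of_not_prefix (hu.2 p a hp ha0 ha) (fun hq => ?_) _ _
      have h1 := hq.length_le
      have h2 := List.length_pos_of_ne_nil hp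
      rw [ha, List.length_append] at h1
      omega

theorem isLyndon_singleton (a : α) : IsLyndon [a] := by
  refine ⟨by simp, fun u v hu hv h => ?_⟩
  have h1 := congrArg List.length h
  have h2 := List.length_pos_of_ne_nil hu
  have h3 := List.length_pos_of_ne_nil hv
  simp only [List.length_append, List.length_cons, List.length_nil] at h1
  omega

theorem exists_factorization_append (fs : List (List α)) (l w : List α) (hl : IsLyndon l)
    (h : IsLyndonFactorization w fs) : ∃ gs, IsLyndonFactorization (l ++ w) gs := by
  induction fs generalizing l w with
  | nil =>
    obtain ⟨rfl, -, -⟩ := h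
    exact ⟨[l], by simp, by simpa using hl, by simp⟩
  | cons f fs ih =>
    obtain ⟨rfl, hL, hs⟩ := h
    rw [List.pairwise_cons] at hs
    by_cases hlf : l < f
    · have := ih (l ++ f) fs.flatten (hl.append (hL f (by simp)) hlf)
        ⟨rfl, fun g hg => hL g (by simp [hg]), hs.2⟩
      simpa using this
    · refine ⟨l :: f :: fs, by simp, ?_, ?_⟩
      · intro g hg
        rcases List.mem_cons.1 hg with rfl | hg
        · exact hl
        · exact hL g hg
      · refine List.pairwise_cons.2 ⟨fun g hg => ?_, List.pairwise_cons.2 hs⟩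
        rcases List.mem_cons.1 hg with rfl | hg
        · exact not_lt.1 hlf
        · exact (hs.1 g hg).trans (not_lt.1 hlf)

theorem exists_lyndonFactorization (w : List α) : ∃ fs, IsLyndonFactorization w fs := by
  induction w with
  | nil => exact ⟨[], by simp [IsLyndonFactorization]⟩
  | cons a w ih =>
    obtain ⟨fs, h⟩ := ih
    exact exists_factorization_append fs [a] w (isLyndon_singleton a) h

theorem exists_suffix_le (f : List α) (fs : List (List α)) (hf : ∀ g ∈ fs, g ≤ f)
    (t : List α) (ht : t ≠ []) (h : t <+: fs.flatten) : ∃ s, s ≠ [] ∧ s <:+ t ∧ s ≤ f := by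
  induction fs generalizing t with
  | nil => exact absurd (List.prefix_nil.1 (by simpa using h)) ht
  | cons g fs ih =>
    obtain ⟨r, hr⟩ := h
    rw [List.flatten_cons] at hr
    rcases List.append_eq_append_iff.1 hr with ⟨a, ha, hb⟩ | ⟨a, ha, hb⟩
    · refine ⟨t, ht, List.suffix_rfl, le_trans ?_ (hf g (by simp))⟩
      by_cases ha0 : a = []
      · subst ha0
        simp [ha]
      · rw [ha]
        exact (lt_append_right' t ha0).le
    · by_cases ha0 : a = []
      · subst ha0
        simp only [List.append_nil] at ha
        exact ⟨t, ht, List.suffix_rfl, ha ▸ hf g (by simp)⟩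
      · obtain ⟨s, hs, hsa, hsf⟩ :=
          ih (fun g hg => hf g (by simp [hg])) a ha0 ⟨r, hb.symm⟩
        exact ⟨s, hs, hsa.trans ⟨g, ha.symm⟩, hsf⟩

theorem first_factor_length_le {f g : List α} {fs gs : List (List α)} {w : List α}
    (hf : IsLyndonFactorization w (f :: fs)) (hg : IsLyndonFactorization w (g :: gs)) :
    g.length ≤ f.length := by
  by_contra hlt
  rw [not_le] at hlt
  obtain ⟨hfw, hfL, hfs⟩ := hf
  obtain ⟨hgw, hgL, -⟩ := hg
  rw [List.flatten_cons] at hfw hgw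
  rw [List.pairwise_cons] at hfs
  have hf0 : f ≠ [] := (hfL f (by simp)).1
  obtain ⟨t, rfl⟩ : f <+: g :=
    List.prefix_of_prefix_length_le ⟨_, hfw⟩ ⟨_, hgw⟩ hlt.le
  have ht : t ≠ [] := by
    rintro rfl
    simp at hlt
  have htp : t <+: fs.flatten := by
    refine ⟨gs.flatten, ?_⟩
    rw [← hgw, List.append_assoc] at hfw
    exact (List.append_cancel_left hfw).symm
  obtain ⟨s, hs, ⟨p, rfl⟩, hsf⟩ := exists_suffix_le f fs hfs.1 t ht htp
  have h1 : f ++ (p ++ s) < s :=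
    (hgL _ (by simp)).2 (f ++ p) s (by simp [hf0]) hs (by simp)
  exact absurd (h1.trans_le hsf) (lt_append_right' f ht).not_gt

theorem lyndonFactorization_unique {w : List α} {fs gs : List (List α)}
    (hf : IsLyndonFactorization w fs) (hg : IsLyndonFactorization w gs) : fs = gs := by
  induction fs generalizing w gs with
  | nil =>
    cases gs with
    | nil => rfl
    | cons g gs =>
      have h := hf.1.trans hg.1.symm
      have h0 := (hg.2.1 g (by simp)).1
      simp [h0] at h
  | cons f fs ih =>
    cases gs with
    | nil =>
      have h := hf.1.trans hg.1.symm
      have h0 := (hf.2.1 f (by simp)).1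
      simp [h0] at h
    | cons g gs =>
      have hlen := le_antisymm (first_factor_length_le hg hf) (first_factor_length_le hf hg)
      have h : f ++ fs.flatten = g ++ gs.flatten := by
        simpa using hf.1.trans hg.1.symm
      obtain ⟨rfl, h2⟩ := List.append_inj h hlen
      congr 1
      exact ih ⟨rfl, fun x hx => hf.2.1 x (by simp [hx]), (List.pairwise_cons.1 hf.2.2).2⟩
        ⟨h2.symm, fun x hx => hg.2.1 x (by simp [hx]), (List.pairwise_cons.1 hg.2.2).2⟩

/-- The factors `ℓ₁ ≥ ℓ₂ ≥ ⋯ ≥ ℓₖ` of the unique factorization of `w` into a weakly decreasing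
product of Lyndon words, listed with multiplicity. -/
noncomputable def lyndonFactors (w : List α) : List (List α) :=
  (exists_lyndonFactorization w).choose

theorem lyndonFactors_spec (w : List α) : IsLyndonFactorization w (lyndonFactors w) :=
  (exists_lyndonFactorization w).choose_spec

theorem lyndonFactors_eq {w : List α} {fs : List (List α)} (h : IsLyndonFactorization w fs) :
    lyndonFactors w = fs :=
  lyndonFactorization_unique (lyndonFactors_spec w) h

/-- The lexicographically smallest nonempty suffix of a nonempty word (the empty word for the
empty word). -/
def minSuffix : List α → List α
  | [] => []
  | [a] => [a]
  | a :: b :: l => min (a :: b :: l) (minSuffix (b :: l))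

theorem minSuffix_suffix (w : List α) : minSuffix w <:+ w := by
  fun_induction minSuffix w with
  | case1 => exact List.suffix_rfl
  | case2 => exact List.suffix_rfl
  | case3 a b l ih =>
    rcases min_choice (a :: b :: l) (minSuffix (b :: l)) with h | h
    · rw [h]
    · rw [h]
      exact ih.trans (List.suffix_cons a _)

theorem minSuffix_ne_nil {w : List α} (hw : w ≠ []) : minSuffix w ≠ [] := by
  fun_induction minSuffix w with
  | case1 => exact hw
  | case2 => exact hw
  | case3 a b l ih =>
    rcases min_choice (a :: b :: l) (minSuffix (b :: l)) with h | h
    · rw [h]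
      exact hw
    · rw [h]
      exact ih (by simp)

theorem minSuffix_le {w s : List α} (hs : s ≠ []) (h : s <:+ w) : minSuffix w ≤ s := by
  fun_induction minSuffix w with
  | case1 => exact absurd (List.suffix_nil.1 h) hs
  | case2 a =>
    rcases List.suffix_cons_iff.1 h with rfl | h
    · exact le_rfl
    · exact absurd (List.suffix_nil.1 h) hs
  | case3 a b l ih =>
    rcases List.suffix_cons_iff.1 h with rfl | h
    · exact min_le_left _ _
    · exact (min_le_right _ _).trans (ih h)

/-- The second factor `v` of the standard factorization `ℓ = uv`: the smallest proper nonempty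
suffix of `ℓ`. -/
def standardRight (l : List α) : List α := minSuffix l.tail

/-- The first factor `u` of the standard factorization `ℓ = uv`. -/
def standardLeft (l : List α) : List α := l.take (l.length - (standardRight l).length)

theorem standardLeft_append_standardRight (l : List α) :
    standardLeft l ++ standardRight l = l := by
  have h : standardRight l <:+ l := (minSuffix_suffix _).trans (List.tail_suffix l)
  obtain ⟨t, ht⟩ := h
  have : standardLeft l = t := by
    unfold standardLeft
    conv_lhs => rw [← ht]
    have : (t ++ standardRight l).length - (standardRight (t ++ standardRight l)).length
        = t.length := by
      rw [ht]
      have := congrArg List.length ht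
      rw [List.length_append] at this
      omega
    rw [this, List.take_left']
    rfl
  rw [this, ht]

theorem standardRight_length_lt (a b : α) (l : List α) :
    (standardRight (a :: b :: l)).length < (a :: b :: l).length := by
  have := (minSuffix_suffix (b :: l)).length_le
  simp only [standardRight, List.tail_cons, List.length_cons] at this ⊢
  omega

theorem standardLeft_length_lt (a b : α) (l : List α) :
    (standardLeft (a :: b :: l)).length < (a :: b :: l).length := by
  have h0 := List.length_pos_of_ne_nil (minSuffix_ne_nil (w := b :: l) (by simp))
  simp only [standardLeft, standardRight, List.tail_cons, List.length_take, List.length_cons]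
  omega

end Words

/-- All shuffles of two words, listed with multiplicity (one entry for each choice of the set of
positions that the letters of the first word occupy). -/
def shuffleWords {α : Type*} : List α → List α → List (List α)
  | [], v => [v]
  | a :: u, [] => [a :: u]
  | a :: u, b :: v =>
      (shuffleWords u (b :: v)).map (List.cons a) ++ (shuffleWords (a :: u) v).map (List.cons b)
termination_by u v => u.length + v.length

/-! ### Noncommutative polynomials

`FreeAlgebra ℚ (Fin n)` is the algebra of noncommutative polynomials in `n` variables. -/

variable {n : ℕ}

/-- The noncommutative monomial `x_{w₁} x_{w₂} ⋯ x_{w_r}` of a word `w`. -/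
noncomputable def monomial (w : List (Fin n)) : FreeAlgebra ℚ (Fin n) :=
  (w.map (FreeAlgebra.ι ℚ)).prod

/-- The shuffle product: the bilinear operation whose value at two monomials is the sum of all
shuffles of the two words. -/
noncomputable def shuffle :
    FreeAlgebra ℚ (Fin n) →ₗ[ℚ] FreeAlgebra ℚ (Fin n) →ₗ[ℚ] FreeAlgebra ℚ (Fin n) :=
  (FreeAlgebra.basisFreeMonoid ℚ (Fin n)).constr ℚ fun u =>
    (FreeAlgebra.basisFreeMonoid ℚ (Fin n)).constr ℚ fun v =>
      ((shuffleWords (FreeMonoid.toList u) (FreeMonoid.toList v)).map monomial).sum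

theorem basisFreeMonoid_eq_monomial (u : List (Fin n)) :
    FreeAlgebra.basisFreeMonoid ℚ (Fin n) (FreeMonoid.ofList u) = monomial u := by
  simp [FreeAlgebra.basisFreeMonoid, FreeAlgebra.equivMonoidAlgebraFreeMonoid, monomial,
    FreeMonoid.lift_apply]

theorem shuffle_monomial (u v : List (Fin n)) :
    shuffle (monomial u) (monomial v) = ((shuffleWords u v).map monomial).sum := by
  rw [← basisFreeMonoid_eq_monomial u, ← basisFreeMonoid_eq_monomial v, shuffle,
    Module.Basis.constr_basis, Module.Basis.constr_basis]
  rfl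

/-- The bracket polynomial `P_ℓ` of a Lyndon word `ℓ`: `P_a = x_a` for a letter `a`, and
`P_ℓ = [P_u, P_v] = P_u P_v - P_v P_u` if `ℓ = uv` is the standard factorization.
(The value at the empty word, which is not Lyndon, is immaterial.) -/
noncomputable def lyndonBracket : List (Fin n) → FreeAlgebra ℚ (Fin n)
  | [] => 0
  | [a] => FreeAlgebra.ι ℚ a
  | a :: b :: l =>
      lyndonBracket (standardLeft (a :: b :: l)) * lyndonBracket (standardRight (a :: b :: l)) -
        lyndonBracket (standardRight (a :: b :: l)) * lyndonBracket (standardLeft (a :: b :: l))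
termination_by l => l.length
decreasing_by
  all_goals first
    | exact standardLeft_length_lt a b l
    | exact standardRight_length_lt a b l

/-- The element `P_w = P_{ℓ₁} P_{ℓ₂} ⋯ P_{ℓₖ}` of the bracket basis, where
`w = ℓ₁ ℓ₂ ⋯ ℓₖ` is the decreasing Lyndon factorization of `w`. -/
noncomputable def bracketElement (w : List (Fin n)) : FreeAlgebra ℚ (Fin n) :=
  ((lyndonFactors w).map lyndonBracket).prod

/-- The Lyndon factors of `w` of length `1`, with multiplicity. -/
noncomputable def letterFactors (w : List (Fin n)) : List (List (Fin n)) :=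
  (lyndonFactors w).filter fun f => f.length = 1

/-- The Lyndon factors of `w` of length greater than `1`, with multiplicity, in decreasing
order. -/
noncomputable def longFactors (w : List (Fin n)) : List (List (Fin n)) :=
  (lyndonFactors w).filter fun f => 1 < f.length

/-- `M(w)`: the shuffle product of the Lyndon factors of `w` of length `1`. -/
noncomputable def shufflePart (w : List (Fin n)) : FreeAlgebra ℚ (Fin n) :=
  ((letterFactors w).map monomial).foldr (fun p q => shuffle p q) 1

/-- `L(w) = P_{w'}`, where `w'` is the product of the Lyndon factors of `w` of length greater
than `1`, in decreasing order. -/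
noncomputable def liePart (w : List (Fin n)) : FreeAlgebra ℚ (Fin n) :=
  bracketElement (longFactors w).flatten

/-- The hybrid element `H_w = M(w) L(w)`. -/
noncomputable def hybridElement (w : List (Fin n)) : FreeAlgebra ℚ (Fin n) :=
  shufflePart w * liePart w

/-- The space of homogeneous noncommutative polynomials of degree `r`: the span of the monomials
of the words of length `r`. -/
noncomputable def degreePart (n r : ℕ) : Submodule ℚ (FreeAlgebra ℚ (Fin n)) :=
  Submodule.span ℚ (monomial '' {w : List (Fin n) | w.length = r})

end HybridBasis

/-!
A sequence of Lyndon words is standard when, for each of its words `f` of length at least two, the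
right factor of the standard factorization of `f` dominates every later word. At the last rise
`u < v` of a standard sequence, `uv` is Lyndon with standard factorization `(u, v)`, so that
`P_u P_v = P_v P_u + P_{uv}`, and both resulting sequences are again standard. Iterating rewrites
the product of the `P_f` as a nonnegative combination of basis elements `P_w`. Swapping keeps the
decreasing arrangement of the sequence, while merging makes its concatenation smaller, so the
leading word is the decreasing product of the original sequence.

The shuffle product of the `m` letter factors of `w` is the sum of the `m!` orderings of these
letters, and every such ordering followed by the long factors of `w` is a standard sequence with
decreasing product `w`; hence `H_w = m! P_w +` smaller terms. A word is itself a standard sequence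
of letters, so the `P_w`, and by triangularity the `H_w`, span the polynomials of degree `r`; there
are as many of them as there are monomials.
-/

namespace HybridBasis

section Triangularity

theorem span_image_le_of_triangular {ι R M : Type*} [LT ι] [Semiring R] [AddCommMonoid M]
    [Module R M] {s : Set ι} (hs : s.WellFoundedOn (· < ·)) {p h : ι → M}
    (hp : ∀ i ∈ s, p i ∈ Submodule.span R (insert (h i) (p '' {j ∈ s | j < i}))) :
    Submodule.span R (p '' s) ≤ Submodule.span R (h '' s) := by
  refine Submodule.span_le.2 (Set.image_subset_iff.2 fun i hi => ?_)
  refine hs.induction hi fun i hi ih => Submodule.span_le.2 ?_ (hp i hi)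
  rintro _ (rfl | ⟨j, ⟨hj, hji⟩, rfl⟩)
  · exact Submodule.subset_span ⟨i, hi, rfl⟩
  · exact ih j hj hji

variable {ι K V : Type*} [Finite ι] [DivisionRing K] [AddCommGroup V] [Module K V] {p h : ι → V}

theorem linearIndependent_of_span_range_le (hp : LinearIndependent K p)
    (hle : Submodule.span K (Set.range p) ≤ Submodule.span K (Set.range h)) :
    LinearIndependent K h := by
  cases nonempty_fintype ι
  have : Module.Finite K (Submodule.span K (Set.range h)) := .span_of_finite K (Set.finite_range h)
  rw [linearIndependent_iff_card_le_finrank_span] at hp ⊢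
  exact hp.trans (Submodule.finrank_mono hle)

theorem span_range_eq_of_le (hp : LinearIndependent K p)
    (hle : Submodule.span K (Set.range p) ≤ Submodule.span K (Set.range h)) :
    Submodule.span K (Set.range p) = Submodule.span K (Set.range h) := by
  cases nonempty_fintype ι
  have : Module.Finite K (Submodule.span K (Set.range h)) := .span_of_finite K (Set.finite_range h)
  refine Submodule.eq_of_le_of_finrank_le hle ?_
  exact (finrank_range_le_card h).trans (linearIndependent_iff_card_le_finrank_span.1 hp)

end Triangularity

section Lists

variable {α β : Type*} [LinearOrder β]

theorem map_singleton_flatten {fs : List (List α)} (h : ∀ f ∈ fs, f.length = 1) :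
    fs.flatten.map (fun a => [a]) = fs := by
  induction fs with
  | nil => rfl
  | cons f fs ih =>
    obtain ⟨a, rfl⟩ := List.length_eq_one_iff.1 (h f List.mem_cons_self)
    simpa using ih fun g hg => h g (List.mem_cons_of_mem _ hg)

theorem sum_map_sub_length_nsmul_mem {ι M : Type*} [AddCommGroup M] {S : AddSubmonoid M}
    {f : ι → M} {c : M} {l : List ι} (h : ∀ i ∈ l, f i - c ∈ S) :
    (l.map f).sum - l.length • c ∈ S := by
  induction l with
  | nil => simp
  | cons i l ih =>
    have hsplit : ((i :: l).map f).sum - (i :: l).length • c =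
        (f i - c) + ((l.map f).sum - l.length • c) := by
      rw [List.map_cons, List.sum_cons, List.length_cons, succ_nsmul]
      abel
    rw [hsplit]
    exact add_mem (h i List.mem_cons_self) (ih fun j hj => h j (List.mem_cons_of_mem _ hj))

theorem exists_last_rise {s : List β} (h : ¬ s.SortedGE) :
    ∃ p a b q, s = p ++ a :: b :: q ∧ a < b ∧ ∀ x ∈ q, x ≤ b := by
  induction s with
  | nil => exact absurd List.Pairwise.nil.sortedGE h
  | cons x t ih =>
    by_cases ht : t.SortedGE
    · cases t with
      | nil => exact absurd (List.pairwise_singleton _ x).sortedGE h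
      | cons b q =>
        have hq : ∀ y ∈ q, y ≤ b := (List.pairwise_cons.1 ht.pairwise).1
        refine ⟨[], x, b, q, rfl, lt_of_not_ge fun hbx => h ?_, hq⟩
        refine (List.pairwise_cons.2 ⟨?_, ht.pairwise⟩).sortedGE
        exact List.forall_mem_cons.2 ⟨hbx, fun y hy => (hq y hy).trans hbx⟩
    · obtain ⟨p, a, b, q, rfl, hab, hq⟩ := ih ht
      exact ⟨x :: p, a, b, q, rfl, hab, hq⟩

/-- The number of pairs of positions `i < j` with `sᵢ < sⱼ`, which measures how far the list is from
being weakly decreasing. -/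
def riseCount : List β → ℕ
  | [] => 0
  | a :: s => s.countP (a < ·) + riseCount s

theorem riseCount_swap_lt {a b : β} (h : a < b) (p q : List β) :
    riseCount (p ++ b :: a :: q) < riseCount (p ++ a :: b :: q) := by
  induction p with
  | nil =>
    simp only [List.nil_append, riseCount, List.countP_cons, h, h.not_gt, decide_true,
      decide_false, if_true, Bool.false_eq_true, if_false]
    omega
  | cons x p ih =>
    have hperm : (p ++ b :: a :: q).Perm (p ++ a :: b :: q) := (List.Perm.swap a b q).append_left p
    simpa only [List.cons_append, riseCount, hperm.countP_eq, add_lt_add_iff_left] using ih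

end Lists

section LyndonWords

variable {α : Type*} [LinearOrder α] {l u v : List α}

theorem monotone_append_left (u : List α) : Monotone (u ++ ·) :=
  StrictMono.monotone fun _ _ => append_lt_append_left' u

theorem IsLyndon.append_lt (hu : IsLyndon u) (hv : IsLyndon v) (h : u < v) : u ++ v < v :=
  (hu.append hv h).2 u v hu.1 hv.1 rfl

theorem IsLyndon.append_append_lt_swap (hu : IsLyndon u) (hv : IsLyndon v) (h : u < v)
    (x : List α) : u ++ v ++ x < v ++ u ++ x := by
  have hlt : u ++ v < v ++ u := (hu.append_lt hv h).trans (lt_append_right' v hu.1)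
  have hnot : ¬ u ++ v <+: v ++ u := fun hpre =>
    hlt.ne (hpre.eq_of_length (by simp [Nat.add_comm]))
  exact append_lt_append_of_not_prefix hlt hnot x x

theorem IsLyndon.lt_standardRight (hl : IsLyndon l) (hlen : 2 ≤ l.length) :
    l < standardRight l := by
  match l, hlen with
  | a :: b :: t, _ =>
    have hfact := standardLeft_append_standardRight (a :: b :: t)
    have hleft : standardLeft (a :: b :: t) ≠ [] := fun hnil => by
      have hlt := standardRight_length_lt a b t
      rw [hnil, List.nil_append] at hfact
      exact hlt.ne (congrArg List.length hfact)
    exact hl.2 _ _ hleft (minSuffix_ne_nil (List.cons_ne_nil b t)) hfact.symm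

theorem minSuffix_append (hv : IsLyndon v) (h : u ≠ [] → v ≤ minSuffix u) :
    minSuffix (u ++ v) = v := by
  refine le_antisymm (minSuffix_le hv.1 (List.suffix_append u v)) ?_
  obtain ⟨p, hp⟩ := minSuffix_suffix (u ++ v)
  have hne : minSuffix (u ++ v) ≠ [] := minSuffix_ne_nil (by simp [hv.1])
  generalize minSuffix (u ++ v) = s at hp hne
  rcases List.append_eq_append_iff.1 hp with ⟨c, rfl, rfl⟩ | ⟨c, -, rfl⟩
  · rcases eq_or_ne c [] with rfl | hc
    · exact le_rfl
    · have hmin : minSuffix (p ++ c) ≤ c := minSuffix_le hc (List.suffix_append p c)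
      exact ((h (by simp [hc])).trans hmin).trans (lt_append_right' c hv.1).le
  · rcases eq_or_ne c [] with rfl | hc
    · exact le_rfl
    · exact (hv.2 c s hc hne rfl).le

end LyndonWords

section StandardSequences

variable {α : Type*} [LinearOrder α] {u v w : List α} {p q s : List (List α)}

/-- Either `u` is a letter or `v` is at most the right factor of the standard factorization of `u`.
For Lyndon words `u < v` this says that `(u, v)` is the standard factorization of `uv`. -/
def IsStandardPair (u v : List α) : Prop := 2 ≤ u.length → v ≤ standardRight u

theorem isStandardPair_singleton (a : α) (v : List α) : IsStandardPair [a] v :=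
  fun h => absurd h (by simp)

theorem IsStandardPair.of_le (h : IsStandardPair u v) (hwv : w ≤ v) : IsStandardPair u w :=
  fun hlen => hwv.trans (h hlen)

theorem IsLyndon.isStandardPair (hu : IsLyndon u) (h : v ≤ u) : IsStandardPair u v :=
  fun hlen => h.trans (hu.lt_standardRight hlen).le

theorem IsStandardPair.standardRight_append (h : IsStandardPair u v) (hu : IsLyndon u)
    (hv : IsLyndon v) : standardRight (u ++ v) = v := by
  obtain ⟨a, t, rfl⟩ := List.exists_cons_of_ne_nil hu.1
  refine minSuffix_append hv fun ht => h ?_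
  simpa [Nat.one_le_iff_ne_zero] using ht

theorem IsStandardPair.standardLeft_append (h : IsStandardPair u v) (hu : IsLyndon u)
    (hv : IsLyndon v) : standardLeft (u ++ v) = u := by
  have hfact := standardLeft_append_standardRight (u ++ v)
  rw [h.standardRight_append hu hv] at hfact
  exact List.append_cancel_right hfact

/-- A standard sequence of Lyndon words: each of its words forms a standard pair with every later
one. -/
def IsStandard (s : List (List α)) : Prop :=
  (∀ f ∈ s, IsLyndon f) ∧ s.Pairwise IsStandardPair

theorem IsStandard.isStandardPair (hs : IsStandard (p ++ u :: v :: q)) : IsStandardPair u v :=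
  List.rel_of_pairwise_cons (List.pairwise_append.1 hs.2).2.1 List.mem_cons_self

theorem IsStandard.swap (hs : IsStandard (p ++ u :: v :: q)) (h : u < v) :
    IsStandard (p ++ v :: u :: q) := by
  obtain ⟨hlyndon, hpair⟩ := hs
  have hperm : (p ++ v :: u :: q).Perm (p ++ u :: v :: q) := (List.Perm.swap u v q).append_left p
  refine ⟨fun f hf => hlyndon f (hperm.mem_iff.1 hf), ?_⟩
  have hvu : IsStandardPair v u := (hlyndon v (by simp)).isStandardPair h.le
  simp only [List.pairwise_append, List.pairwise_cons, List.mem_cons, forall_eq_or_imp] at hpair ⊢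
  obtain ⟨hp, ⟨⟨-, huq⟩, hvq, hqq⟩, hpq⟩ := hpair
  exact ⟨hp, ⟨⟨hvu, hvq⟩, huq, hqq⟩, fun f hf => and_left_comm.1 (hpq f hf)⟩

theorem IsStandard.merge (hs : IsStandard (p ++ u :: v :: q)) (h : u < v) (hq : ∀ x ∈ q, x ≤ v) :
    IsStandard (p ++ (u ++ v) :: q) := by
  have huv := hs.isStandardPair
  obtain ⟨hlyndon, hpair⟩ := hs
  have hu : IsLyndon u := hlyndon u (by simp)
  have hv : IsLyndon v := hlyndon v (by simp)
  refine ⟨fun f hf => ?_, ?_⟩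
  · rw [List.mem_append, List.mem_cons] at hf
    rcases hf with hf | rfl | hf
    · exact hlyndon f (by simp [hf])
    · exact hu.append hv h
    · exact hlyndon f (by simp [hf])
  · simp only [List.pairwise_append, List.pairwise_cons, List.mem_cons, forall_eq_or_imp]
      at hpair ⊢
    obtain ⟨hp, ⟨-, -, hqq⟩, hpq⟩ := hpair
    refine ⟨hp, ⟨fun x hx _ => ?_, hqq⟩, fun f hf => ⟨?_, (hpq f hf).2.2⟩⟩
    · rw [huv.standardRight_append hu hv]
      exact hq x hx
    · exact (hpq f hf).2.1.of_le (hu.append_lt hv h).le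

theorem isStandard_map_singleton_append (x : List α) (hlyndon : ∀ f ∈ s, IsLyndon f)
    (hs : s.SortedGE) : IsStandard (x.map (fun a => [a]) ++ s) := by
  refine ⟨List.forall_mem_append.2 ⟨?_, hlyndon⟩, List.pairwise_append.2 ⟨?_, ?_, ?_⟩⟩
  · exact List.forall_mem_map.2 fun a _ => isLyndon_singleton a
  · exact List.pairwise_map.2 (List.pairwise_of_forall fun a b => isStandardPair_singleton a [b])
  · exact hs.pairwise.imp_of_mem fun hf _ hgf => (hlyndon _ hf).isStandardPair hgf
  · exact List.forall_mem_map.2 fun a _ g _ => isStandardPair_singleton a g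

theorem IsStandard.straightening_induction {C : List (List α) → Prop}
    (sorted : ∀ s, IsStandard s → s.SortedGE → C s)
    (rise : ∀ p u v q, IsStandard (p ++ u :: v :: q) → u < v →
      C (p ++ v :: u :: q) → C (p ++ (u ++ v) :: q) → C (p ++ u :: v :: q))
    {s : List (List α)} (hs : IsStandard s) : C s := by
  by_cases hsorted : s.SortedGE
  · exact sorted s hs hsorted
  · obtain ⟨p, u, v, q, rfl, huv, hq⟩ := exists_last_rise hsorted
    exact rise p u v q hs huv (straightening_induction sorted rise (hs.swap huv))
      (straightening_induction sorted rise (hs.merge huv hq))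
termination_by (s.length, riseCount s)
decreasing_by
  all_goals subst s
  · simpa [Prod.lex_def] using riseCount_swap_lt huv p q
  · simp [Prod.lex_def]

end StandardSequences

section DescendingProducts

variable {α : Type*} [LinearOrder α] {f u v : List α} {s t : List (List α)}

/-- The concatenation, in weakly decreasing order, of a list of words. -/
def descendingProduct (s : List (List α)) : List α := (s.insertionSort (· ≥ ·)).flatten

theorem descendingProduct_of_sortedGE (hs : s.SortedGE) : descendingProduct s = s.flatten := by
  rw [descendingProduct, hs.pairwise.insertionSort_eq]

theorem descendingProduct_congr (h : s.Perm t) : descendingProduct s = descendingProduct t := by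
  have hperm : (s.insertionSort (· ≥ ·)).Perm (t.insertionSort (· ≥ ·)) :=
    (List.perm_insertionSort _ s).trans (h.trans (List.perm_insertionSort _ t).symm)
  rw [descendingProduct, descendingProduct,
    hperm.eq_of_sortedGE List.sortedGE_insertionSort List.sortedGE_insertionSort]

theorem length_descendingProduct (s : List (List α)) :
    (descendingProduct s).length = s.flatten.length :=
  (List.perm_insertionSort _ s).flatten.length_eq

theorem append_flatten_le_flatten_orderedInsert (hf : IsLyndon f) (hs : ∀ g ∈ s, IsLyndon g) :
    f ++ s.flatten ≤ (s.orderedInsert (· ≥ ·) f).flatten := by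
  induction s with
  | nil => simp
  | cons g s ih =>
    rw [List.orderedInsert_cons]
    split_ifs with hgf
    · rfl
    · have hlt : f ++ g ++ s.flatten < g ++ f ++ s.flatten :=
        hf.append_append_lt_swap (hs g List.mem_cons_self) (lt_of_not_ge hgf) s.flatten
      have hle : f ++ s.flatten ≤ (s.orderedInsert (· ≥ ·) f).flatten :=
        ih fun x hx => hs x (List.mem_cons_of_mem _ hx)
      simp only [List.append_assoc, List.flatten_cons] at hlt ⊢
      exact hlt.le.trans (monotone_append_left g hle)

theorem flatten_le_descendingProduct (hs : ∀ f ∈ s, IsLyndon f) :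
    s.flatten ≤ descendingProduct s := by
  induction s with
  | nil => exact le_rfl
  | cons f s ih =>
    rw [List.forall_mem_cons] at hs
    calc f ++ s.flatten ≤ f ++ descendingProduct s := monotone_append_left f (ih hs.2)
      _ ≤ descendingProduct (f :: s) := append_flatten_le_flatten_orderedInsert hs.1
          fun g hg => hs.2 g ((List.mem_insertionSort _).1 hg)

theorem descendingProduct_merge_lt (hs : ∀ f ∈ u :: v :: s, IsLyndon f) (h : u < v) :
    descendingProduct ((u ++ v) :: s) < descendingProduct (u :: v :: s) := by
  have hsort := List.perm_insertionSort (· ≥ ·) ((u ++ v) :: s)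
  obtain ⟨a, b, hab⟩ := List.append_of_mem (hsort.mem_iff.2 List.mem_cons_self)
  have hperm : (a ++ v :: u :: b).Perm (u :: v :: s) := by
    have hrest : (a ++ b).Perm s := (List.perm_middle.symm.trans (hab ▸ hsort)).cons_inv
    calc (a ++ v :: u :: b).Perm (v :: u :: (a ++ b)) :=
          List.perm_middle.trans (List.perm_middle.cons v)
      _ |>.Perm (u :: v :: (a ++ b)) := List.Perm.swap u v _
      _ |>.Perm (u :: v :: s) := (hrest.cons v).cons u
  calc descendingProduct ((u ++ v) :: s) = a.flatten ++ (u ++ v ++ b.flatten) := by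
        rw [descendingProduct, hab, List.flatten_append, List.flatten_cons]
    _ < a.flatten ++ (v ++ u ++ b.flatten) :=
        append_lt_append_left' _ ((hs u (by simp)).append_append_lt_swap (hs v (by simp)) h _)
    _ = (a ++ v :: u :: b).flatten := by simp
    _ ≤ descendingProduct (a ++ v :: u :: b) :=
        flatten_le_descendingProduct fun f hf => hs f (hperm.mem_iff.1 hf)
    _ = descendingProduct (u :: v :: s) := descendingProduct_congr hperm

end DescendingProducts

section LetterShuffles

variable {n : ℕ}

theorem shuffleWords_singleton {α : Type*} (a : α) :
    shuffleWords [a] = List.permutations'Aux a := by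
  funext v
  induction v with
  | nil => simp [shuffleWords]
  | cons b v ih => simp [shuffleWords, ih]

theorem shuffle_sum_map_monomial (u : List (Fin n)) (vs : List (List (Fin n))) :
    shuffle (monomial u) (vs.map monomial).sum =
      ((vs.flatMap (shuffleWords u)).map monomial).sum := by
  induction vs with
  | nil => simp
  | cons v vs ih => simp [shuffle_monomial, ih]

theorem foldr_shuffle_letters (x : List (Fin n)) :
    ((x.map fun a => [a]).map monomial).foldr (fun p q => shuffle p q) 1 =
      (x.permutations'.map monomial).sum := by
  induction x with
  | nil => simp [monomial]
  | cons a x ih =>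
    simp only [List.map_cons, List.foldr_cons, ih, shuffle_sum_map_monomial, shuffleWords_singleton,
      List.permutations']

end LetterShuffles

section Straightening

variable {n : ℕ} {u v w : List (Fin n)} {s : List (List (Fin n))} {x : FreeAlgebra ℚ (Fin n)}

theorem prod_map_lyndonBracket_letters (x : List (Fin n)) :
    ((x.map fun a => [a]).map lyndonBracket).prod = monomial x := by
  simp [monomial, Function.comp_def, lyndonBracket]

theorem IsStandardPair.lyndonBracket_append (h : IsStandardPair u v) (hu : IsLyndon u)
    (hv : IsLyndon v) :
    lyndonBracket (u ++ v) =
      lyndonBracket u * lyndonBracket v - lyndonBracket v * lyndonBracket u := by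
  obtain ⟨a, t, rfl⟩ := List.exists_cons_of_ne_nil hu.1
  obtain ⟨b, l, hbl⟩ := List.exists_cons_of_ne_nil (show t ++ v ≠ [] by simp [hv.1])
  have hcons : a :: t ++ v = a :: b :: l := by rw [List.cons_append, hbl]
  rw [hcons, lyndonBracket, ← hcons, h.standardLeft_append hu hv, h.standardRight_append hu hv]

theorem IsLyndonFactorization.bracketElement_eq (h : IsLyndonFactorization w s) :
    bracketElement w = (s.map lyndonBracket).prod := by
  rw [bracketElement, lyndonFactors_eq h]

/-- The cone of nonnegative rational combinations of the elements `P_u`, for words `u` that have the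
length of `w` and are smaller than `w`. -/
noncomputable def lowerCone (w : List (Fin n)) : PointedCone ℚ (FreeAlgebra ℚ (Fin n)) :=
  PointedCone.hull ℚ (bracketElement '' {u | u.length = w.length ∧ u < w})

theorem exists_finsupp_of_mem_lowerCone (hx : x ∈ lowerCone w) :
    ∃ c : List (Fin n) →₀ ℚ, (∀ u ∈ c.support, u.length = w.length ∧ u < w) ∧ (∀ u, 0 ≤ c u) ∧
      x = c.sum fun u q => q • bracketElement u := by
  obtain ⟨c, hsupport, rfl⟩ := (Finsupp.mem_span_image_iff_linearCombination _).1 hx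
  refine ⟨c.mapRange Subtype.val rfl, fun u hu => hsupport (Finsupp.support_mapRange hu),
    fun u => (c u).2, ?_⟩
  exact (Finsupp.sum_mapRange_index (h := fun u q => q • bracketElement u) fun u =>
    zero_smul ℚ (bracketElement u)).symm

theorem lowerCone_subset_span (w : List (Fin n)) :
    (lowerCone w : Set (FreeAlgebra ℚ (Fin n))) ⊆
      Submodule.span ℚ (bracketElement '' {u | u.length = w.length ∧ u < w}) :=
  Submodule.span_subset_span _ _ _

theorem mem_lowerCone_of_sub_mem (hlen : u.length = w.length) (h : u < w)
    (hx : x - bracketElement u ∈ lowerCone u) : x ∈ lowerCone w := by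
  have hle : lowerCone u ≤ lowerCone w :=
    Submodule.span_mono (Set.image_mono fun y hy => ⟨hy.1.trans hlen, hy.2.trans h⟩)
  have hu : bracketElement u ∈ lowerCone w := Submodule.subset_span ⟨u, ⟨hlen, h⟩, rfl⟩
  simpa only [sub_add_cancel] using add_mem (hle hx) hu

theorem IsStandard.prod_map_lyndonBracket_sub_mem_lowerCone (hs : IsStandard s) :
    (s.map lyndonBracket).prod - bracketElement (descendingProduct s) ∈
      lowerCone (descendingProduct s) := by
  refine IsStandard.straightening_induction (C := fun s => (s.map lyndonBracket).prod -
    bracketElement (descendingProduct s) ∈ lowerCone (descendingProduct s)) ?sorted ?rise hs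
  case sorted =>
    intro s hs hsorted
    have hfact : IsLyndonFactorization s.flatten s := ⟨rfl, hs.1, hsorted.pairwise⟩
    rw [descendingProduct_of_sortedGE hsorted, hfact.bracketElement_eq, sub_self]
    exact zero_mem _
  case rise =>
    intro p u v q hs huv hswap hmerge
    have hbracket := hs.isStandardPair.lyndonBracket_append (hs.1 u (by simp)) (hs.1 v (by simp))
    have hrewrite : ((p ++ u :: v :: q).map lyndonBracket).prod =
        ((p ++ v :: u :: q).map lyndonBracket).prod +
          ((p ++ (u ++ v) :: q).map lyndonBracket).prod := by
      simp only [List.map_append, List.map_cons, List.prod_append, List.prod_cons, hbracket]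
      noncomm_ring
    have hswap_eq : descendingProduct (p ++ v :: u :: q) = descendingProduct (p ++ u :: v :: q) :=
      descendingProduct_congr ((List.Perm.swap u v q).append_left p)
    have hmerge_lt :
        descendingProduct (p ++ (u ++ v) :: q) < descendingProduct (p ++ u :: v :: q) := by
      have hperm : (p ++ u :: v :: q).Perm (u :: v :: (p ++ q)) :=
        List.perm_middle.trans (List.perm_middle.cons u)
      rw [descendingProduct_congr hperm, descendingProduct_congr List.perm_middle]
      exact descendingProduct_merge_lt (fun f hf => hs.1 f (hperm.mem_iff.2 hf)) huv
    rw [hswap_eq] at hswap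
    rw [hrewrite, add_sub_right_comm]
    refine add_mem hswap (mem_lowerCone_of_sub_mem ?_ hmerge_lt hmerge)
    simp [length_descendingProduct]

theorem monomial_mem_span_bracketElement (v : List (Fin n)) :
    monomial v ∈ Submodule.span ℚ (bracketElement '' {u | u.length = v.length}) := by
  set w := descendingProduct (v.map fun a => [a]) with hw
  have hlen : w.length = v.length := by
    simp [hw, length_descendingProduct, Function.comp_def]
  have hstandard : IsStandard (v.map fun a => [a]) := by
    simpa using isStandard_map_singleton_append v (s := []) (by simp) List.Pairwise.nil.sortedGE
  have hcone := hstandard.prod_map_lyndonBracket_sub_mem_lowerCone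
  rw [prod_map_lyndonBracket_letters, ← hw] at hcone
  have hsub : {u : List (Fin n) | u.length = w.length ∧ u < w} ⊆ {u | u.length = v.length} :=
    fun u hu => hu.1.trans hlen
  have hlower := Submodule.span_mono (Set.image_mono hsub) (lowerCone_subset_span w hcone)
  have hleading : bracketElement w ∈
      Submodule.span ℚ (bracketElement '' {u : List (Fin n) | u.length = v.length}) :=
    Submodule.subset_span ⟨w, hlen, rfl⟩
  exact (Submodule.sub_mem_iff_left _ hleading).1 hlower

end Straightening

section HybridElements

variable {n : ℕ}

theorem letterFactors_append_longFactors_perm (w : List (Fin n)) :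
    (letterFactors w ++ longFactors w).Perm (lyndonFactors w) := by
  have hlong : longFactors w = (lyndonFactors w).filter fun f => !decide (f.length = 1) := by
    refine List.filter_congr fun f hf => ?_
    have hpos := List.length_pos_of_ne_nil ((lyndonFactors_spec w).2.1 f hf).1
    rw [← decide_not, decide_eq_decide]
    omega
  rw [hlong]
  exact List.filter_append_perm _ _

theorem map_singleton_flatten_letterFactors (w : List (Fin n)) :
    (letterFactors w).flatten.map (fun a => [a]) = letterFactors w :=
  map_singleton_flatten fun f hf => by simpa using (List.mem_filter.1 hf).2

theorem shufflePart_eq_sum_monomial (w : List (Fin n)) :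
    shufflePart w = ((letterFactors w).flatten.permutations'.map monomial).sum := by
  rw [shufflePart, ← foldr_shuffle_letters, map_singleton_flatten_letterFactors]

theorem monomial_mul_liePart_sub_mem_lowerCone {x w : List (Fin n)}
    (hx : x.Perm (letterFactors w).flatten) :
    monomial x * liePart w - bracketElement w ∈ lowerCone w := by
  obtain ⟨hflatten, hlyndon, hsorted⟩ := lyndonFactors_spec w
  have hlong : ∀ f ∈ longFactors w, IsLyndon f := fun f hf => hlyndon f (List.mem_filter.1 hf).1
  have hlong_sorted : (longFactors w).Pairwise (fun f g => g ≤ f) := hsorted.filter _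
  have hlong_fact : IsLyndonFactorization (longFactors w).flatten (longFactors w) :=
    ⟨rfl, hlong, hlong_sorted⟩
  have hstandard := isStandard_map_singleton_append x hlong hlong_sorted.sortedGE
  have hperm : (x.map (fun a => [a]) ++ longFactors w).Perm (lyndonFactors w) := by
    refine List.Perm.trans (List.Perm.append_right _ ?_) (letterFactors_append_longFactors_perm w)
    simpa only [map_singleton_flatten_letterFactors] using hx.map fun a => [a]
  have hproduct : descendingProduct (x.map (fun a => [a]) ++ longFactors w) = w := by
    rw [descendingProduct_congr hperm, descendingProduct_of_sortedGE hsorted.sortedGE, hflatten]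
  have hcone := hstandard.prod_map_lyndonBracket_sub_mem_lowerCone
  rwa [hproduct, List.map_append, List.prod_append, prod_map_lyndonBracket_letters,
    ← hlong_fact.bracketElement_eq] at hcone

theorem hybridElement_sub_mem_lowerCone (w : List (Fin n)) :
    hybridElement w - ((letterFactors w).length.factorial : ℚ) • bracketElement w ∈
      lowerCone w := by
  have hlen : (letterFactors w).flatten.permutations'.length =
      (letterFactors w).length.factorial := by
    rw [(List.permutations_perm_permutations' _).symm.length_eq, List.length_permutations,
      ← List.length_map (f := fun a => [a]), map_singleton_flatten_letterFactors]
  have hsum : hybridElement w =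
      ((letterFactors w).flatten.permutations'.map fun x => monomial x * liePart w).sum := by
    rw [hybridElement, shufflePart_eq_sum_monomial, List.sum_map_mul_right]
  rw [hsum, ← hlen, Nat.cast_smul_eq_nsmul]
  exact sum_map_sub_length_nsmul_mem (S := (lowerCone w).toAddSubmonoid) fun x hx =>
    monomial_mul_liePart_sub_mem_lowerCone (List.mem_permutations'.1 hx)

end HybridElements

section Basis

variable {n : ℕ}

theorem linearIndependent_monomial :
    LinearIndependent ℚ (monomial : List (Fin n) → FreeAlgebra ℚ (Fin n)) := by
  have heq : (monomial : List (Fin n) → FreeAlgebra ℚ (Fin n)) =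
      FreeAlgebra.basisFreeMonoid ℚ (Fin n) ∘ FreeMonoid.ofList :=
    funext fun u => (basisFreeMonoid_eq_monomial u).symm
  rw [heq]
  exact (FreeAlgebra.basisFreeMonoid ℚ (Fin n)).linearIndependent.comp _ FreeMonoid.ofList.injective

theorem bracketElement_mem_span_insert (w : List (Fin n)) :
    bracketElement w ∈ Submodule.span ℚ
      (insert (hybridElement w) (bracketElement '' {u | u.length = w.length ∧ u < w})) := by
  have hfactorial : ((letterFactors w).length.factorial : ℚ) ≠ 0 := by positivity
  have hlower := Submodule.span_mono (Set.subset_insert (hybridElement w) _)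
    (lowerCone_subset_span w (hybridElement_sub_mem_lowerCone w))
  rw [← Submodule.smul_mem_iff _ hfactorial]
  exact (Submodule.sub_mem_iff_right _ (Submodule.subset_span (Set.mem_insert _ _))).1 hlower

theorem degreePart_le_span_hybridElement (n r : ℕ) :
    degreePart n r ≤ Submodule.span ℚ (hybridElement '' {w : List (Fin n) | w.length = r}) := by
  calc degreePart n r
      ≤ Submodule.span ℚ (bracketElement '' {w | w.length = r}) := by
        refine Submodule.span_le.2 ?_
        rintro _ ⟨v, rfl, rfl⟩
        exact monomial_mem_span_bracketElement v
    _ ≤ Submodule.span ℚ (hybridElement '' {w | w.length = r}) := by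
        refine span_image_le_of_triangular (List.finite_length_eq _ r).wellFoundedOn ?_
        rintro w rfl
        exact bracketElement_mem_span_insert w

theorem exists_basis_hybridElement (n r : ℕ) :
    ∃ b : Module.Basis {w : List (Fin n) // w.length = r} ℚ (degreePart n r),
      ∀ w, (b w : FreeAlgebra ℚ (Fin n)) = hybridElement w.1 := by
  let words := {w : List (Fin n) | w.length = r}
  have : Finite words := (List.finite_length_eq _ r).to_subtype
  have hmonomial : LinearIndependent ℚ fun w : words => monomial w.1 :=
    linearIndependent_monomial.comp _ Subtype.val_injective
  have hdegree : degreePart n r = Submodule.span ℚ (Set.range fun w : words => monomial w.1) := by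
    rw [degreePart, Set.image_eq_range]
  have hle := degreePart_le_span_hybridElement n r
  rw [hdegree, Set.image_eq_range] at hle
  have hspan := hdegree.trans (span_range_eq_of_le hmonomial hle)
  have hhybrid := linearIndependent_of_span_range_le hmonomial hle
  refine ⟨(Module.Basis.span hhybrid).map (LinearEquiv.ofEq _ _ hspan.symm), fun w => ?_⟩
  rw [Module.Basis.map_apply, LinearEquiv.coe_ofEq_apply, Module.Basis.span_apply]

end Basis

end HybridBasis

theorem mainTheorem6 (n r : ℕ) :
    (∀ w : List (Fin n), w.length = r →
      ∃ c : List (Fin n) →₀ ℚ,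
        (∀ u ∈ c.support, u.length = r ∧ u < w) ∧
        (∀ u, 0 ≤ c u) ∧
        HybridBasis.hybridElement w =
          ((HybridBasis.letterFactors w).length.factorial : ℚ) • HybridBasis.bracketElement w +
            c.sum fun u q => q • HybridBasis.bracketElement u) ∧
    ∃ b : Module.Basis {w : List (Fin n) // w.length = r} ℚ (HybridBasis.degreePart n r),
      ∀ w, (b w : FreeAlgebra ℚ (Fin n)) = HybridBasis.hybridElement w.1 := by
  refine ⟨fun w hw => ?_, HybridBasis.exists_basis_hybridElement n r⟩
  obtain ⟨c, hsupport, hnonneg, hsum⟩ :=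
    HybridBasis.exists_finsupp_of_mem_lowerCone (HybridBasis.hybridElement_sub_mem_lowerCone w)
  exact ⟨c, hw ▸ hsupport, hnonneg, sub_eq_iff_eq_add'.1 hsum⟩
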